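/- **Laplace transform of the 2nd level fractional derivative on the half-axis.** All functions are complex-valued (in particular, real-valued functions are covered) and are taken modulo equality almost everywhere on $(0,\infty)$. $L_{loc}(\mathbb R_+)$ is the set of functions that are Lebesgue integrable on $(0,b)$ for every $b>0$. For $f\in L_{loc}(\mathbb R_+)$ let $I^0f=f$ and, for $\beta>0$, $$(I^\beta f)(x)=\frac1{\Gamma(\beta)}\int_0^x (x-t)^{\beta-1}f(t)\,dt,\qquad x>0 .$$ $AC_{loc}$ is the set of functions $g$ for which there are $c\in\mathbb C$ and $\varphi\in L_{loc}(\mathbb R_+)$ with $g(x)=c+\int_0^x\varphi(t)\,dt$ for almost all $x>0$; then $c$ and (almost everywhere) $\varphi$ are unique, and one puts $g(0)=c$, $\frac{dg}{dx}=\varphi$. The Laplace transform of $f\in L_{loc}(\mathbb R_+)$ at $s\in\mathbb C$ is $\mathcal L f(s)=\lim_{R\to\infty}\int_0^R f(t)e^{-st}\,dt$, and it is said to exist if this limit exists (for absolutely convergent integrals it is the Lebesgue integral over $(0,\infty)$). Powers $s^z$ are principal values. Let $0<\alpha\le 1$. (1) Let $\gamma_1,\gamma_2\ge 0$, $\alpha+\gamma_1\le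 1$, $\alpha+\gamma_1+\gamma_2\le 2$, and let $X_{2L+}$ be the set of all $f\in L_{loc}(\mathbb R_+)$ such that $I^{2-\alpha-\gamma_1-\gamma_2}f$ and $I^{\gamma_2}\frac{d}{dx}I^{2-\alpha-\gamma_1-\gamma_2}f$ belong to $AC_{loc}$. For $f\in X_{2L+}$ put $$D^{\alpha,(\gamma_1,\gamma_2)}_{2L+}f=I^{\gamma_1}\frac{d}{dx}I^{\gamma_2}\frac{d}{dx}I^{2-\alpha-\gamma_1-\gamma_2}f,\quad a_1=\Big(I^{\gamma_2}\frac{d}{dx}I^{2-\alpha-\gamma_1-\gamma_2}f\Big)(0),\quad a_2=\big(I^{2-\alpha-\gamma_1-\gamma_2}f\big)(0).$$ Assume $\gamma_2<1$ and $1<\alpha+\gamma_1+\gamma_2$. If $f\in X_{2L+}$, $\operatorname{Re}s>0$ and the Laplace transform of $D^{\alpha,(\gamma_1,\gamma_2)}_{2L+}f$ exists at $s$, then the Laplace transform of $f$ exists at $s$ and $$\mathcal L\big(D^{\alpha,(\gamma_1,\gamma_2)}_{2L+}f\big)(s)=s^\alpha\mathcal Lf(s)-a_1s^{-\gamma_1}-a_2s^{1-\gamma_1-\gamma_2}.$$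 (2) For $\gamma\ge 0$ with $\alpha+\gamma\le 1$ let $X_{H+}^{\gamma}$ be the set of all $f\in L_{loc}(\mathbb R_+)$ with $I^{1-\alpha-\gamma}f\in AC_{loc}$, and let $D^{\alpha,\gamma}_{H+}f=I^{\gamma}\frac{d}{dx}I^{1-\alpha-\gamma}f$ be the Hilfer derivative of $f\in X_{H+}^{\gamma}$. Let $\gamma_1,\gamma_2$ satisfy the conditions in the first sentence of (1). If $\gamma_2\ge1$, then, with $\gamma=\gamma_1+\gamma_2-1$ (so $\gamma=\gamma_1$ for $\gamma_2=1$), $X_{2L+}=X_{H+}^{\gamma}$, and for each $f$ in this space $D^{\alpha,(\gamma_1,\gamma_2)}_{2L+}f=D^{\alpha,\gamma}_{H+}f$ a.e., $a_1=0$, $a_2=(I^{1-\alpha-\gamma}f)(0)$. If $\alpha+\gamma_1+\gamma_2\le1$, then $X_{2L+}=X_{H+}^{\gamma_1}$, and for each $f$ in this space $D^{\alpha,(\gamma_1,\gamma_2)}_{2L+}f=D^{\alpha,\gamma_1}_{H+}f$ a.e., $a_1=(I^{1-\alpha-\gamma_1}f)(0)$, $a_2=0$. (3) Let $\operatorname{Re}s>0$.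 In each of the following cases, if the Laplace transform of the derivative of $f$ exists at $s$, then so does that of $f$, and the formula holds. Hilfer, for $\gamma_1\ge0$, $\alpha+\gamma_1\le1$, $f\in X_{H+}^{\gamma_1}$: $$\mathcal L(D^{\alpha,\gamma_1}_{H+}f)(s)=s^\alpha\mathcal Lf(s)-(I^{1-\alpha-\gamma_1}f)(0)\,s^{-\gamma_1};$$ Riemann–Liouville, $D^\alpha_{0+}f=\frac{d}{dx}I^{1-\alpha}f$ for $f\in L_{loc}(\mathbb R_+)$ with $I^{1-\alpha}f\in AC_{loc}$, which is the case $\gamma_1=0$ of the Hilfer derivative: $$\mathcal L(D^{\alpha}_{0+}f)(s)=s^\alpha\mathcal Lf(s)-(I^{1-\alpha}f)(0);$$ Caputo, $D^\alpha_{C+}f=I^{1-\alpha}\frac{df}{dx}$ for $f\in AC_{loc}$, which is the case $\gamma_1=1-\alpha$ of the Hilfer derivative: $$\mathcal L(D^{\alpha}_{C+}f)(s)=s^\alpha\mathcal Lf(s)-f(0)\,s^{\alpha-1}.$$ -/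

import Mathlib

open MeasureTheory Set Filter Topology

namespace FracCalc

/-- `f` belongs to `L_loc(ℝ₊)`, `ℝ₊ = [0, ∞)`: it is Lebesgue integrable on every `(0, b)`. -/
def LocInt (f : ℝ → ℂ) : Prop :=
  LocallyIntegrableOn f (Ici 0) volume

/-- The Riemann-Liouville fractional integral `I^α_{0+}` on the half-axis, `α ≥ 0`
(only the values at `x > 0` matter). -/
noncomputable def rlInt (α : ℝ) (f : ℝ → ℂ) (x : ℝ) : ℂ :=
  if α = 0 then f x
  else (1 / Real.Gamma α : ℝ) * ∫ t in (0 : ℝ)..x, (((x - t) ^ (α - 1) : ℝ) : ℂ) * f t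

/-- `g(x) = c + ∫₀ˣ φ(t) dt` for almost all `x > 0`, with `φ ∈ L_loc(ℝ₊)`: the function class of `g`
has the locally absolutely continuous representative `c + ∫₀ˣ φ`, whose value at `0` is `c` and
whose (weak) derivative is `φ`. -/
def IsACRep (g : ℝ → ℂ) (c : ℂ) (φ : ℝ → ℂ) : Prop :=
  LocInt φ ∧ ∀ᵐ x ∂(volume.restrict (Ioi (0 : ℝ))), g x = c + ∫ t in (0 : ℝ)..x, φ t

/-- `g ∈ AC_loc([0, ∞))` (as a class of functions modulo equality almost everywhere). -/
def MemAC (g : ℝ → ℂ) : Prop :=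
  ∃ c φ, IsACRep g c φ

open Classical in
/-- The value `g(0)` of (the continuous representative of) `g ∈ AC_loc([0, ∞))`. -/
noncomputable def valueAtZero (g : ℝ → ℂ) : ℂ :=
  if h : MemAC g then h.choose else 0

open Classical in
/-- The derivative `dg/dx ∈ L_loc(ℝ₊)` of `g ∈ AC_loc([0, ∞))`. -/
noncomputable def acDeriv (g : ℝ → ℂ) : ℝ → ℂ :=
  if h : MemAC g then h.choose_spec.choose else 0

/-- The initial value and the derivative are well defined, the latter almost everywhere. -/
theorem IsACRep.unique {g φ φ' : ℝ → ℂ} {c c' : ℂ} (h : IsACRep g c φ) (h' : IsACRep g c' φ') :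
    c = c' ∧ φ =ᵐ[volume.restrict (Ioi (0 : ℝ))] φ' := by
  have hint : ∀ {ψ : ℝ → ℂ}, LocInt ψ → ∀ b : ℝ, 0 ≤ b → IntervalIntegrable ψ volume 0 b := by
    intro ψ hψ b hb
    rw [intervalIntegrable_iff_integrableOn_Icc_of_le hb]
    exact hψ.integrableOn_compact_subset Icc_subset_Ici_self isCompact_Icc
  have hd : LocInt (fun t => φ t - φ' t) := h.1.sub h'.1
  set F : ℝ → ℂ := fun x => ∫ t in (0 : ℝ)..x, (φ t - φ' t) with hF
  have hcont : ContinuousOn F (Ici 0) := by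
    intro x hx
    have hx0 : (0 : ℝ) ≤ x + 1 := by have : (0 : ℝ) ≤ x := hx; linarith
    have h1 : ContinuousOn F (uIcc 0 (x + 1)) :=
      intervalIntegral.continuousOn_primitive_interval
        (by rw [uIcc_of_le hx0]
            exact hd.integrableOn_compact_subset Icc_subset_Ici_self isCompact_Icc)
    rw [uIcc_of_le hx0] at h1
    refine (h1 x ⟨hx, by linarith⟩).mono_of_mem_nhdsWithin ?_
    rw [← Ici_inter_Iic]
    exact inter_mem self_mem_nhdsWithin (mem_nhdsWithin_of_mem_nhds (Iic_mem_nhds (by linarith)))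
  have hae : ∀ᵐ x ∂(volume.restrict (Ioi (0 : ℝ))), F x = c' - c := by
    filter_upwards [h.2, h'.2, ae_restrict_mem measurableSet_Ioi] with x h1 h2 hx
    have hx' : (0 : ℝ) ≤ x := le_of_lt hx
    simp only [hF]
    rw [intervalIntegral.integral_sub (hint h.1 x hx') (hint h'.1 x hx')]
    rw [h1] at h2
    linear_combination h2
  have heq : EqOn F (fun _ => c' - c) (Ioi 0) :=
    Measure.eqOn_open_of_ae_eq hae isOpen_Ioi (hcont.mono Ioi_subset_Ici_self) continuousOn_const
  have heq' : EqOn F (fun _ => c' - c) (Ici 0) :=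
    heq.of_subset_closure hcont continuousOn_const Ioi_subset_Ici_self (by rw [closure_Ioi])
  have h0 : c' - c = 0 := by
    have := heq' (self_mem_Ici (a := (0 : ℝ)))
    simpa [hF] using this.symm
  refine ⟨(sub_eq_zero.mp h0).symm, ?_⟩
  have hz : ∀ᵐ x ∂(volume.restrict (Ioi (0 : ℝ))), φ x - φ' x = 0 := by
    have hn : ∀ n : ℕ, ∀ᵐ x ∂(volume.restrict (Ioo (0 : ℝ) n)), φ x - φ' x = 0 := by
      intro n
      have hii : IntervalIntegrable (fun t => φ t - φ' t) volume 0 n :=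
        hint hd n (Nat.cast_nonneg n)
      rw [ae_restrict_iff' measurableSet_Ioo]
      filter_upwards [hii.ae_hasDerivAt_integral] with x hx hxm
      have hm : x ∈ uIcc (0 : ℝ) n := by
        rw [uIcc_of_le (Nat.cast_nonneg n)]; exact Ioo_subset_Icc_self hxm
      have hD := hx hm 0 (left_mem_uIcc)
      have hc : HasDerivAt F 0 x := by
        refine (hasDerivAt_const x (c' - c)).congr_of_eventuallyEq ?_
        filter_upwards [Ioi_mem_nhds hxm.1] with y hy using heq hy
      exact hD.unique hc
    have hU : Ioi (0 : ℝ) ⊆ ⋃ n : ℕ, Ioo (0 : ℝ) n := by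
      intro x hx
      obtain ⟨n, hn⟩ := exists_nat_gt x
      exact mem_iUnion.2 ⟨n, hx, hn⟩
    exact ae_restrict_of_ae_restrict_of_subset hU ((ae_restrict_iUnion_iff _ _).2 hn)
  filter_upwards [hz] with x hx using sub_eq_zero.mp hx

theorem IsACRep.valueAtZero_eq {g φ : ℝ → ℂ} {c : ℂ} (h : IsACRep g c φ) :
    valueAtZero g = c := by
  have hm : MemAC g := ⟨c, φ, h⟩
  rw [valueAtZero, dif_pos hm]
  exact (hm.choose_spec.choose_spec.unique h).1

theorem IsACRep.acDeriv_ae_eq {g φ : ℝ → ℂ} {c : ℂ} (h : IsACRep g c φ) :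
    acDeriv g =ᵐ[volume.restrict (Ioi (0 : ℝ))] φ := by
  have hm : MemAC g := ⟨c, φ, h⟩
  rw [acDeriv, dif_pos hm]
  exact (hm.choose_spec.choose_spec.unique h).2

/-- The domain `X¹_{2L+}` of the 2nd level fractional derivative on the half-axis. -/
def MemDom2L (α γ₁ γ₂ : ℝ) (f : ℝ → ℂ) : Prop :=
  LocInt f ∧ MemAC (rlInt (2 - α - γ₁ - γ₂) f) ∧
    MemAC (rlInt γ₂ (acDeriv (rlInt (2 - α - γ₁ - γ₂) f)))

/-- The 2nd level fractional derivative `I^{γ₁} d/dx I^{γ₂} d/dx I^{2-α-γ₁-γ₂}`. -/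
noncomputable def deriv2L (α γ₁ γ₂ : ℝ) (f : ℝ → ℂ) : ℝ → ℂ :=
  rlInt γ₁ (acDeriv (rlInt γ₂ (acDeriv (rlInt (2 - α - γ₁ - γ₂) f))))

/-- `a₁ = (I^{γ₂} d/dx I^{2-α-γ₁-γ₂} f)(0)`. -/
noncomputable def coeffA1 (α γ₁ γ₂ : ℝ) (f : ℝ → ℂ) : ℂ :=
  valueAtZero (rlInt γ₂ (acDeriv (rlInt (2 - α - γ₁ - γ₂) f)))

/-- `a₂ = (I^{2-α-γ₁-γ₂} f)(0)`. -/
noncomputable def coeffA2 (α γ₁ γ₂ : ℝ) (f : ℝ → ℂ) : ℂ :=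
  valueAtZero (rlInt (2 - α - γ₁ - γ₂) f)

/-- The domain of the Hilfer fractional derivative on the half-axis. -/
def MemDomHilfer (α γ₁ : ℝ) (f : ℝ → ℂ) : Prop :=
  LocInt f ∧ MemAC (rlInt (1 - α - γ₁) f)

/-- The Hilfer fractional derivative `I^{γ₁} d/dx I^{1-α-γ₁}`. -/
noncomputable def derivHilfer (α γ₁ : ℝ) (f : ℝ → ℂ) : ℝ → ℂ :=
  rlInt γ₁ (acDeriv (rlInt (1 - α - γ₁) f))

/-- The domain of the Riemann-Liouville fractional derivative on the half-axis. -/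
def MemDomRL (α : ℝ) (f : ℝ → ℂ) : Prop :=
  LocInt f ∧ MemAC (rlInt (1 - α) f)

/-- The Riemann-Liouville fractional derivative `d/dx I^{1-α}`. -/
noncomputable def derivRL (α : ℝ) (f : ℝ → ℂ) : ℝ → ℂ :=
  acDeriv (rlInt (1 - α) f)

/-- The Caputo fractional derivative `I^{1-α} d/dx`; its domain is `AC_loc([0, ∞))`. -/
noncomputable def derivCaputo (α : ℝ) (f : ℝ → ℂ) : ℝ → ℂ :=
  rlInt (1 - α) (acDeriv f)

/-- The Laplace integral `∫₀^∞ f(t) e^{-st} dt` exists at `s`, as an improper integral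
(absolute convergence is not required). -/
def LaplaceExists (f : ℝ → ℂ) (s : ℂ) : Prop :=
  LocInt f ∧ ∃ F : ℂ,
    Tendsto (fun R : ℝ => ∫ t in (0 : ℝ)..R, f t * Complex.exp (-(s * t))) atTop (𝓝 F)

/-- The Laplace transform `(L f)(s) = ∫₀^∞ f(t) e^{-st} dt`. -/
noncomputable def laplace (f : ℝ → ℂ) (s : ℂ) : ℂ :=
  limUnder atTop (fun R : ℝ => ∫ t in (0 : ℝ)..R, f t * Complex.exp (-(s * t)))

/-- For absolutely convergent Laplace integrals, `laplace` is the Lebesgue integral. -/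
theorem laplace_eq_integral {f : ℝ → ℂ} {s : ℂ} (hf : LocInt f)
    (h : IntegrableOn (fun t : ℝ => f t * Complex.exp (-(s * t))) (Ioi 0)) :
    LaplaceExists f s ∧ laplace f s = ∫ t in Ioi (0 : ℝ), f t * Complex.exp (-(s * t)) := by
  have ht := intervalIntegral_tendsto_integral_Ioi 0 h tendsto_id
  exact ⟨⟨hf, _, ht⟩, ht.limUnder_eq⟩

end FracCalc

/-! Write k_β(t) = t^(β-1)/Γ(β), so that I^β f = f * k_β, D for the derivative and, in the 2nd level
case, β = 2-α-γ₁-γ₂. The proof inverts the derivative: almost everywhere f = I^α D f + a₁ k_{α+γ₁} +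
a₂ k_{α+γ₁+γ₂-1} (`MemDom2L.ae_eq`), with a single kernel term for Hilfer (`MemDomHilfer.ae_eq`).
The Laplace transform of k_β is s^(-β), and I^α multiplies a transform by s^(-α). Hence every term
on the right has a transform as soon as D f has one; f inherits existence, and multiplication by s^α
gives the formula.

The inversion avoids differentiation. Applying I^{2-α-γ₁} to both sides turns each into I²ψ + a₁ k₂
+ a₂ k_{γ₂+1}, where ψ = d/dx I^{γ₂} d/dx I^β f, by the semigroup law (`rlInt_rlInt`); fractional
integrals are injective (`rlInt_injective`).

The Laplace integral of D f may converge only conditionally, so Fubini on (0, ∞) is not available.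
`tendsto_integral_hconv` replaces it: the weighted kernel is absolutely integrable, and the
primitive of the other factor is bounded and has a limit. -/

namespace FracCalc

/-! ### Locally integrable functions on the half-axis -/

/-- Lebesgue measure on `(0, ∞)`. -/
noncomputable abbrev posVol : Measure ℝ := volume.restrict (Ioi 0)

theorem locInt_iff {f : ℝ → ℂ} : LocInt f ↔ ∀ b : ℝ, IntegrableOn f (Ioc 0 b) := by
  rw [LocInt, locallyIntegrableOn_iff isClosed_Ici.isLocallyClosed]
  constructor
  · intro h b
    exact (h (Icc 0 b) Icc_subset_Ici_self isCompact_Icc).mono_set Ioc_subset_Icc_self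
  · intro h k hk hc
    obtain ⟨b, hb⟩ := hc.bddAbove
    have : IntegrableOn f (Icc 0 b) := by
      rw [integrableOn_Icc_iff_integrableOn_Ioc]; exact h b
    exact this.mono_set fun x hx => ⟨hk hx, hb hx⟩

theorem LocInt.intervalIntegrable {f : ℝ → ℂ} (hf : LocInt f) {a b : ℝ} (ha : 0 ≤ a)
    (hb : 0 ≤ b) : IntervalIntegrable f volume a b := by
  have h : ∀ c : ℝ, 0 ≤ c → IntervalIntegrable f volume 0 c := fun c hc => by
    rw [intervalIntegrable_iff_integrableOn_Ioc_of_le hc]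
    exact locInt_iff.1 hf c
  exact (h a ha).symm.trans (h b hb)

theorem ae_pos_iff {p : ℝ → Prop} :
    (∀ᵐ x ∂posVol, p x) ↔ ∀ b : ℝ, ∀ᵐ x : ℝ, x ∈ Ioc 0 b → p x := by
  constructor
  · intro h b
    rw [ae_restrict_iff' measurableSet_Ioi] at h
    filter_upwards [h] with x hx hxb using hx hxb.1
  · intro h
    have h' : ∀ᵐ x : ℝ, ∀ n : ℕ, x ∈ Ioc (0 : ℝ) n → p x := ae_all_iff.2 fun n => h n
    rw [ae_restrict_iff' measurableSet_Ioi]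
    filter_upwards [h'] with x hx hx0
    obtain ⟨n, hn⟩ := exists_nat_gt x
    exact hx n ⟨hx0, hn.le⟩

theorem LocInt.congr {f g : ℝ → ℂ} (hf : LocInt f) (h : f =ᵐ[posVol] g) : LocInt g := by
  rw [locInt_iff] at hf ⊢
  exact fun b => (hf b).congr (ae_restrict_of_ae_restrict_of_subset Ioc_subset_Ioi_self h)

theorem LocInt.const_mul {f : ℝ → ℂ} (hf : LocInt f) (c : ℂ) : LocInt fun t => c * f t := by
  rw [locInt_iff] at hf ⊢
  exact fun b => (hf b).const_mul c

theorem integral_congr_pos {f g : ℝ → ℂ} (h : f =ᵐ[posVol] g) {x : ℝ} (hx : 0 ≤ x) :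
    ∫ t in (0 : ℝ)..x, f t = ∫ t in (0 : ℝ)..x, g t := by
  rw [intervalIntegral.integral_of_le hx, intervalIntegral.integral_of_le hx]
  exact integral_congr_ae (ae_restrict_of_ae_restrict_of_subset Ioc_subset_Ioi_self h)

/-! ### The convolution on the half-axis -/

/-- The convolution `∫₀ˣ f(t) g(x - t) dt` of functions on the half-axis. -/
noncomputable def hconv (f g : ℝ → ℂ) (x : ℝ) : ℂ :=
  ∫ t in (0 : ℝ)..x, f t * g (x - t)

/-- Restriction of a function to `(0, b]`, extended by zero. -/
noncomputable def cut (b : ℝ) (f : ℝ → ℂ) : ℝ → ℂ := indicator (Ioc 0 b) f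

theorem cut_apply {b : ℝ} {f : ℝ → ℂ} {t : ℝ} (h0 : 0 < t) (hb : t ≤ b) : cut b f t = f t :=
  indicator_of_mem (show t ∈ Ioc 0 b from ⟨h0, hb⟩) f

theorem cut_nonpos {b : ℝ} {f : ℝ → ℂ} {t : ℝ} (h0 : t ≤ 0) : cut b f t = 0 :=
  indicator_of_notMem (fun h : t ∈ Ioc 0 b => absurd h.1 h0.not_gt) f

theorem LocInt.integrable_cut {f : ℝ → ℂ} (hf : LocInt f) (b : ℝ) : Integrable (cut b f) :=
  (integrable_indicator_iff measurableSet_Ioc).2 (locInt_iff.1 hf b)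

/-- The multiplication of complex numbers as a real bilinear map. -/
noncomputable abbrev mulC : ℂ →L[ℝ] ℂ →L[ℝ] ℂ := ContinuousLinearMap.mul ℝ ℂ

theorem hconv_comm (f g : ℝ → ℂ) (x : ℝ) : hconv f g x = hconv g f x := by
  have := intervalIntegral.integral_comp_sub_left (a := 0) (b := x) (fun t => f t * g (x - t)) x
  simp only [sub_self, sub_zero, sub_sub_cancel] at this
  rw [hconv, ← this, hconv]
  exact intervalIntegral.integral_congr fun t _ => mul_comm _ _

theorem hconv_congr_left {f f' : ℝ → ℂ} (h : f =ᵐ[posVol] f') (g : ℝ → ℂ) {x : ℝ} (hx : 0 ≤ x) :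
    hconv f g x = hconv f' g x :=
  integral_congr_pos (by filter_upwards [h] with t ht using by rw [ht]) hx

theorem hconv_congr_right (f : ℝ → ℂ) {g g' : ℝ → ℂ} (h : g =ᵐ[posVol] g') {x : ℝ}
    (hx : 0 ≤ x) : hconv f g x = hconv f g' x := by
  rw [hconv_comm, hconv_congr_left h f hx, hconv_comm]

theorem hconv_congr_of_eqOn {f f' g g' : ℝ → ℂ} {x : ℝ} (hx : 0 ≤ x)
    (hf : ∀ t, 0 < t → t < x → f t = f' t) (hg : ∀ t, 0 < t → t < x → g t = g' t) :
    hconv f g x = hconv f' g' x := by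
  rw [hconv, hconv, intervalIntegral.integral_of_le hx, intervalIntegral.integral_of_le hx,
    integral_Ioc_eq_integral_Ioo, integral_Ioc_eq_integral_Ioo]
  refine setIntegral_congr_fun measurableSet_Ioo fun t ht => ?_
  rw [hf t ht.1 ht.2, hg (x - t) (by linarith [ht.2]) (by linarith [ht.1])]

theorem convolution_eq_hconv {f g : ℝ → ℂ} (hf : ∀ t ≤ 0, f t = 0) (hg : ∀ t ≤ 0, g t = 0)
    {x : ℝ} (hx : 0 ≤ x) : convolution f g mulC volume x = hconv f g x := by
  rw [hconv, intervalIntegral.integral_of_le hx, convolution_def, eq_comm]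
  refine setIntegral_eq_integral_of_forall_compl_eq_zero fun t ht => ?_
  rw [mem_Ioc, not_and_or, not_lt, not_le] at ht
  rcases ht with ht | ht
  · simp [hf t ht]
  · simp [hg (x - t) (by linarith)]

theorem convolution_nonpos {f g : ℝ → ℂ} (hf : ∀ t ≤ 0, f t = 0) (hg : ∀ t ≤ 0, g t = 0)
    {x : ℝ} (hx : x ≤ 0) : convolution f g mulC volume x = 0 := by
  rw [convolution_def]
  refine integral_eq_zero_of_ae (Eventually.of_forall fun t => ?_)
  rcases le_total t 0 with ht | ht
  · simp [hf t ht]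
  · simp [hg (x - t) (by linarith)]

theorem hconv_eq_convolution_cut (f g : ℝ → ℂ) {b x : ℝ} (hx : 0 ≤ x) (hb : x ≤ b) :
    hconv f g x = convolution (cut b f) (cut b g) mulC volume x := by
  rw [convolution_eq_hconv (fun _ => cut_nonpos) (fun _ => cut_nonpos) hx]
  exact hconv_congr_of_eqOn hx (fun t h0 h1 => (cut_apply h0 (h1.le.trans hb)).symm)
    (fun t h0 h1 => (cut_apply h0 (h1.le.trans hb)).symm)

theorem LocInt.hconv {f g : ℝ → ℂ} (hf : LocInt f) (hg : LocInt g) : LocInt (hconv f g) := by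
  rw [locInt_iff]
  intro b
  have h : Integrable (convolution (cut b f) (cut b g) mulC volume) :=
    (hf.integrable_cut b).integrable_convolution mulC (hg.integrable_cut b)
  exact h.integrableOn.congr_fun
    (fun x hx => (hconv_eq_convolution_cut f g hx.1.le hx.2).symm) measurableSet_Ioc

theorem LocInt.ae_intervalIntegrable_hconv {f g : ℝ → ℂ} (hf : LocInt f) (hg : LocInt g) :
    ∀ᵐ x ∂posVol, IntervalIntegrable (fun t => f t * g (x - t)) volume 0 x := by
  rw [ae_pos_iff]
  intro b
  filter_upwards [(hf.integrable_cut b).ae_convolution_exists mulC (hg.integrable_cut b)]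
    with x hx hxb
  rw [intervalIntegrable_iff_integrableOn_Ioo_of_le hxb.1.le]
  refine (hx.integrable.integrableOn (s := Ioo 0 x)).congr_fun (fun t ht => ?_) measurableSet_Ioo
  simp only [ContinuousLinearMap.mul_apply']
  rw [cut_apply ht.1 (ht.2.le.trans hxb.2),
    cut_apply (by linarith [ht.2]) (by linarith [ht.1, hxb.2])]

/-- On [0, b] the half-axis convolution sees only values on (0, b]. Truncation there gives
integrable functions on ℝ, to which associativity of the whole-line convolution applies. The
pointwise hypothesis `he` is isolated because it holds almost everywhere in general, but everywhere
if one factor is bounded. -/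
theorem hconv_assoc_of_convolutionExistsAt {f g h : ℝ → ℂ} (hf : LocInt f) (hg : LocInt g)
    (hh : LocInt h) {b x : ℝ} (hx : 0 ≤ x) (hb : x ≤ b)
    (he : ConvolutionExistsAt (fun t => ‖cut b f t‖)
      (convolution (fun t => ‖cut b g t‖) (fun t => ‖cut b h t‖)
        (ContinuousLinearMap.mul ℝ ℝ) volume) x (ContinuousLinearMap.mul ℝ ℝ) volume) :
    hconv (hconv f g) h x = hconv f (hconv g h) x := by
  have hF := hf.integrable_cut b
  have hG := hg.integrable_cut b
  have hH := hh.integrable_cut b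
  have key := convolution_assoc mulC mulC mulC mulC (fun a b c => mul_assoc a b c)
    hF.aestronglyMeasurable hG.aestronglyMeasurable hH.aestronglyMeasurable
    (hF.ae_convolution_exists mulC hG) (hG.norm.ae_convolution_exists _ hH.norm) he
  have h0 : ∀ p : ℝ → ℂ, ∀ t ≤ 0, cut b p t = 0 := fun p t => cut_nonpos
  rw [convolution_eq_hconv (fun t => convolution_nonpos (h0 f) (h0 g)) (h0 h) hx,
    convolution_eq_hconv (h0 f) (fun t => convolution_nonpos (h0 g) (h0 h)) hx] at key
  have e : ∀ p : ℝ → ℂ, ∀ t, 0 < t → t < x → p t = cut b p t :=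
    fun p t h0 h1 => (cut_apply h0 (h1.le.trans hb)).symm
  rw [hconv_congr_of_eqOn hx (fun t h0 h1 => hconv_eq_convolution_cut f g h0.le (h1.le.trans hb))
    (e h), key]
  exact (hconv_congr_of_eqOn hx (e f)
    (fun t h0 h1 => hconv_eq_convolution_cut g h h0.le (h1.le.trans hb))).symm

theorem hconv_assoc_ae {f g h : ℝ → ℂ} (hf : LocInt f) (hg : LocInt g) (hh : LocInt h) :
    hconv (hconv f g) h =ᵐ[posVol] hconv f (hconv g h) := by
  refine ae_pos_iff.2 fun b => ?_
  have hG := (hg.integrable_cut b).norm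
  have hH := (hh.integrable_cut b).norm
  filter_upwards [(hf.integrable_cut b).norm.ae_convolution_exists (ContinuousLinearMap.mul ℝ ℝ)
    (hG.integrable_convolution (ContinuousLinearMap.mul ℝ ℝ) hH)] with x hx hxb
  exact hconv_assoc_of_convolutionExistsAt hf hg hh hxb.1.le hxb.2 hx

/-- Used with `h = 1`: the limit as R → ∞ requires the identity at every R, not just almost every
one. -/
theorem hconv_assoc_of_bounded {f g h : ℝ → ℂ} (hf : LocInt f) (hg : LocInt g) (hh : LocInt h)
    {C : ℝ} (hC : ∀ t, ‖h t‖ ≤ C) {x : ℝ} (hx : 0 ≤ x) :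
    hconv (hconv f g) h x = hconv f (hconv g h) x := by
  refine hconv_assoc_of_convolutionExistsAt hf hg hh hx le_rfl ?_
  have hG := (hg.integrable_cut x).norm
  have hH := (hh.integrable_cut x).norm
  have hm := (hG.integrable_convolution (ContinuousLinearMap.mul ℝ ℝ) hH).aestronglyMeasurable
  have hm' := hm.comp_quasiMeasurePreserving
    (quasiMeasurePreserving_sub_left_of_right_invariant volume x)
  -- The inner convolution is bounded by C times the L¹ norm of the truncated `g`, so its product
  -- with the integrable truncation of `|f|` is integrable at every point.
  refine (hf.integrable_cut x).norm.mul_bdd (c := ∫ t, ‖cut x g t‖ * C) hm'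
    (Eventually.of_forall fun t => ?_)
  refine norm_integral_le_of_norm_le (hG.mul_const C) (Eventually.of_forall fun s => ?_)
  simp only [ContinuousLinearMap.mul_apply', norm_mul, norm_norm]
  gcongr
  exact (norm_indicator_le_norm_self h _).trans (hC _)

/-- Only almost everywhere: where a convolution integral diverges it takes the default value 0, and
additivity can fail. -/
theorem hconv_add_ae {f f' g : ℝ → ℂ} (hf : LocInt f) (hf' : LocInt f') (hg : LocInt g) :
    hconv (fun t => f t + f' t) g =ᵐ[posVol] fun x => hconv f g x + hconv f' g x := by
  filter_upwards [hf.ae_intervalIntegrable_hconv hg, hf'.ae_intervalIntegrable_hconv hg]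
    with x h1 h2
  simp only [hconv]
  rw [← intervalIntegral.integral_add h1 h2]
  simp only [add_mul]

theorem hconv_const_mul (c : ℂ) (f g : ℝ → ℂ) (x : ℝ) :
    hconv (fun t => c * f t) g x = c * hconv f g x := by
  simp only [hconv]
  rw [← intervalIntegral.integral_const_mul]
  simp only [mul_assoc]

theorem hconv_one (f : ℝ → ℂ) (x : ℝ) : hconv f (fun _ => 1) x = ∫ t in (0 : ℝ)..x, f t := by
  simp [hconv]

end FracCalc

namespace FracCalc

/-! ### Fractional integrals -/

/-- The kernel `t^(β-1) / Γ(β)` of the fractional integral of order `β`. -/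
noncomputable def rlKernel (β t : ℝ) : ℂ := ((t ^ (β - 1) / Real.Gamma β : ℝ) : ℂ)

theorem locInt_rlKernel {β : ℝ} (hβ : 0 < β) : LocInt (rlKernel β) := by
  rw [locInt_iff]
  intro b
  rcases le_total b 0 with hb | hb
  · rw [Ioc_eq_empty hb.not_gt]; exact integrableOn_empty
  · have h : IntervalIntegrable (fun t : ℝ => t ^ (β - 1)) volume 0 b :=
      intervalIntegral.intervalIntegrable_rpow' (by linarith)
    rw [intervalIntegrable_iff_integrableOn_Ioc_of_le hb] at h
    exact (h.div_const _).ofReal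

theorem rlKernel_one (t : ℝ) : rlKernel 1 t = 1 := by simp [rlKernel]

theorem rlInt_zero (f : ℝ → ℂ) : rlInt 0 f = f := by
  funext x; simp [rlInt]

theorem rlInt_eq_hconv {β : ℝ} (hβ : β ≠ 0) (f : ℝ → ℂ) : rlInt β f = hconv f (rlKernel β) := by
  funext x
  rw [rlInt, if_neg hβ, hconv, ← intervalIntegral.integral_const_mul]
  refine intervalIntegral.integral_congr fun t _ => ?_
  simp only [rlKernel]
  push_cast
  ring

theorem rlInt_one (f : ℝ → ℂ) (x : ℝ) : rlInt 1 f x = ∫ t in (0 : ℝ)..x, f t := by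
  rw [rlInt_eq_hconv one_ne_zero, ← hconv_one]
  simp only [hconv, rlKernel_one]

/-- Euler's beta integral rescaled from [0, 1] to [0, x], with B(a, b) = Γ(a)Γ(b)/Γ(a+b). -/
theorem hconv_rlKernel {a b : ℝ} (ha : 0 < a) (hb : 0 < b) {x : ℝ} (hx : 0 < x) :
    hconv (rlKernel a) (rlKernel b) x = rlKernel (a + b) x := by
  have hGa : Complex.Gamma a ≠ 0 := Complex.Gamma_ne_zero_of_re_pos (by simpa using ha)
  have hGb : Complex.Gamma b ≠ 0 := Complex.Gamma_ne_zero_of_re_pos (by simpa using hb)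
  have hGab : Complex.Gamma (a + b) ≠ 0 :=
    Complex.Gamma_ne_zero_of_re_pos (by simpa using add_pos ha hb)
  have hB := Complex.Gamma_mul_Gamma_eq_betaIntegral (s := a) (t := b) (by simpa using ha)
    (by simpa using hb)
  have hS := Complex.betaIntegral_scaled a b hx
  have e : hconv (rlKernel a) (rlKernel b) x = (Complex.Gamma a)⁻¹ * (Complex.Gamma b)⁻¹ *
      ∫ t in (0 : ℝ)..x, (t : ℂ) ^ ((a : ℂ) - 1) * ((x : ℂ) - t) ^ ((b : ℂ) - 1) := by
    rw [hconv, ← intervalIntegral.integral_const_mul]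
    refine intervalIntegral.integral_congr fun t ht => ?_
    rw [uIcc_of_le hx.le] at ht
    simp only [rlKernel]
    push_cast
    rw [Complex.ofReal_cpow ht.1, Complex.ofReal_cpow (sub_nonneg.2 ht.2), ← Complex.Gamma_ofReal,
      ← Complex.Gamma_ofReal]
    push_cast
    ring
  rw [e, hS, rlKernel]
  push_cast
  rw [Complex.ofReal_cpow hx.le, ← Complex.Gamma_ofReal]
  push_cast
  field_simp
  rw [hB]
  ring

theorem rlInt_rlKernel {a b : ℝ} (ha : 0 ≤ a) (hb : 0 < b) :
    rlInt a (rlKernel b) =ᵐ[posVol] rlKernel (a + b) := by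
  rcases ha.eq_or_lt with rfl | ha
  · rw [rlInt_zero, zero_add]
  · rw [rlInt_eq_hconv ha.ne']
    filter_upwards [ae_restrict_mem measurableSet_Ioi] with x hx
    rw [hconv_rlKernel hb ha hx, add_comm]

theorem LocInt.rlInt {f : ℝ → ℂ} (hf : LocInt f) {β : ℝ} (hβ : 0 ≤ β) : LocInt (rlInt β f) := by
  rcases hβ.eq_or_lt with rfl | hβ
  · rwa [rlInt_zero]
  · rw [rlInt_eq_hconv hβ.ne']
    exact hf.hconv (locInt_rlKernel hβ)

theorem rlInt_congr {f g : ℝ → ℂ} (h : f =ᵐ[posVol] g) (β : ℝ) :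
    rlInt β f =ᵐ[posVol] rlInt β g := by
  rcases eq_or_ne β 0 with rfl | hβ
  · rwa [rlInt_zero, rlInt_zero]
  · rw [rlInt_eq_hconv hβ, rlInt_eq_hconv hβ]
    filter_upwards [ae_restrict_mem measurableSet_Ioi] with x hx
    exact hconv_congr_left h _ (le_of_lt hx)

theorem rlInt_add {f g : ℝ → ℂ} (hf : LocInt f) (hg : LocInt g) {β : ℝ} (hβ : 0 ≤ β) :
    rlInt β (fun t => f t + g t) =ᵐ[posVol] fun x => rlInt β f x + rlInt β g x := by
  rcases hβ.eq_or_lt with rfl | hβ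
  · simp only [rlInt_zero]; rfl
  · simp only [rlInt_eq_hconv hβ.ne']
    exact hconv_add_ae hf hg (locInt_rlKernel hβ)

theorem rlInt_const_mul (c : ℂ) (f : ℝ → ℂ) (β x : ℝ) :
    rlInt β (fun t => c * f t) x = c * rlInt β f x := by
  rcases eq_or_ne β 0 with rfl | hβ
  · simp only [rlInt_zero]
  · simp only [rlInt_eq_hconv hβ, hconv_const_mul]

/-- The semigroup property of the fractional integrals. -/
theorem rlInt_rlInt {f : ℝ → ℂ} (hf : LocInt f) {a b : ℝ} (ha : 0 ≤ a) (hb : 0 ≤ b) :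
    rlInt a (rlInt b f) =ᵐ[posVol] rlInt (a + b) f := by
  rcases ha.eq_or_lt with rfl | ha
  · rw [rlInt_zero, zero_add]
  rcases hb.eq_or_lt with rfl | hb
  · rw [rlInt_zero, add_zero]
  rw [rlInt_eq_hconv ha.ne', rlInt_eq_hconv hb.ne', rlInt_eq_hconv (add_pos ha hb).ne']
  filter_upwards [hconv_assoc_ae hf (locInt_rlKernel hb) (locInt_rlKernel ha),
    ae_restrict_mem measurableSet_Ioi] with x h hx
  rw [h]
  refine hconv_congr_right f ?_ (le_of_lt hx)
  filter_upwards [ae_restrict_mem measurableSet_Ioi] with t ht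
  rw [hconv_rlKernel hb ha ht, add_comm]

/-- Both functions are derivatives of the same absolutely continuous class, so uniqueness of the
representation applies. -/
theorem rlInt_one_injective {f g : ℝ → ℂ} (hf : LocInt f) (hg : LocInt g)
    (h : rlInt 1 f =ᵐ[posVol] rlInt 1 g) : f =ᵐ[posVol] g := by
  have h1 : IsACRep (rlInt 1 f) 0 f := ⟨hf, Eventually.of_forall fun x => by simp [rlInt_one]⟩
  have h2 : IsACRep (rlInt 1 f) 0 g := ⟨hg, by
    filter_upwards [h] with x hx
    rw [hx, rlInt_one, zero_add]⟩
  exact (h1.unique h2).2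

/-- Applying I^{n-β} with an integer n ≥ β reduces to integer order, where order-one injectivity is
iterated. -/
theorem rlInt_injective {f g : ℝ → ℂ} (hf : LocInt f) (hg : LocInt g) {β : ℝ} (hβ : 0 ≤ β)
    (h : rlInt β f =ᵐ[posVol] rlInt β g) : f =ᵐ[posVol] g := by
  have step : ∀ n : ℕ, rlInt n f =ᵐ[posVol] rlInt n g → f =ᵐ[posVol] g := by
    intro n
    induction n with
    | zero => intro h; simpa [rlInt_zero] using h
    | succ n ih =>
      intro h
      refine ih (rlInt_one_injective (hf.rlInt n.cast_nonneg) (hg.rlInt n.cast_nonneg) ?_)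
      push_cast at h
      rw [add_comm] at h
      exact (rlInt_rlInt hf zero_le_one n.cast_nonneg).trans
        (h.trans (rlInt_rlInt hg zero_le_one n.cast_nonneg).symm)
  obtain ⟨n, hn⟩ := exists_nat_ge β
  refine step n ?_
  have h1 := rlInt_rlInt hf (sub_nonneg.2 hn) hβ
  have h2 := rlInt_rlInt hg (sub_nonneg.2 hn) hβ
  rw [sub_add_cancel] at h1 h2
  exact h1.symm.trans ((rlInt_congr h _).trans h2)

/-! ### Absolutely continuous functions -/

theorem MemAC.isACRep {g : ℝ → ℂ} (h : MemAC g) : IsACRep g (valueAtZero g) (acDeriv g) := by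
  obtain ⟨c, φ, hφ⟩ := h
  rw [hφ.valueAtZero_eq]
  have hd := hφ.acDeriv_ae_eq
  refine ⟨hφ.1.congr hd.symm, ?_⟩
  filter_upwards [hφ.2, ae_restrict_mem measurableSet_Ioi] with x hx hx0
  rw [hx, integral_congr_pos hd (le_of_lt hx0)]

theorem IsACRep.congr {g g' φ φ' : ℝ → ℂ} {c : ℂ} (h : IsACRep g c φ) (hg : g =ᵐ[posVol] g')
    (hφ : φ =ᵐ[posVol] φ') : IsACRep g' c φ' := by
  refine ⟨h.1.congr hφ, ?_⟩
  filter_upwards [h.2, hg, ae_restrict_mem measurableSet_Ioi] with x hx hx' hx0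
  rw [← hx', hx, integral_congr_pos hφ (le_of_lt hx0)]

theorem MemAC.congr {g g' : ℝ → ℂ} (h : MemAC g) (hg : g =ᵐ[posVol] g') : MemAC g' := by
  obtain ⟨c, φ, hφ⟩ := h
  exact ⟨c, φ, hφ.congr hg EventuallyEq.rfl⟩

theorem isACRep_iff {g φ : ℝ → ℂ} {c : ℂ} : IsACRep g c φ ↔
    LocInt φ ∧ g =ᵐ[posVol] fun x => c * rlKernel 1 x + rlInt 1 φ x := by
  simp only [IsACRep, rlKernel_one, mul_one, rlInt_one]
  rfl

/-- Since I^β = I¹ I^{β-1}, absolute continuity is automatic for orders at least 1. This is what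
makes the degenerate types collapse. -/
theorem isACRep_rlInt {f : ℝ → ℂ} (hf : LocInt f) {β : ℝ} (hβ : 1 ≤ β) :
    IsACRep (rlInt β f) 0 (rlInt (β - 1) f) := by
  refine isACRep_iff.2 ⟨hf.rlInt (sub_nonneg.2 hβ), ?_⟩
  have h := rlInt_rlInt hf zero_le_one (sub_nonneg.2 hβ)
  rw [add_sub_cancel] at h
  filter_upwards [h] with x hx
  rw [hx, zero_mul, zero_add]

theorem MemAC.locInt {g : ℝ → ℂ} (h : MemAC g) : LocInt g := by
  obtain ⟨c, φ, hφ⟩ := h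
  obtain ⟨h1, h2⟩ := isACRep_iff.1 hφ
  exact LocInt.congr (((locInt_rlKernel one_pos).const_mul c).add (h1.rlInt zero_le_one)) h2.symm

/-- The inversion of the Hilfer derivative. -/
theorem MemDomHilfer.ae_eq {α γ : ℝ} (hα : 0 < α) (hγ : 0 ≤ γ) (h1 : α + γ ≤ 1) {f : ℝ → ℂ}
    (hf : MemDomHilfer α γ f) : LocInt (derivHilfer α γ f) ∧
      f =ᵐ[posVol] fun x => rlInt α (derivHilfer α γ f) x +
        valueAtZero (rlInt (1 - α - γ) f) * rlKernel (α + γ) x := by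
  obtain ⟨hφ, hg⟩ := isACRep_iff.1 hf.2.isACRep
  set c := valueAtZero (rlInt (1 - α - γ) f)
  set φ := acDeriv (rlInt (1 - α - γ) f)
  have hD : derivHilfer α γ f = rlInt γ φ := rfl
  have hDl : LocInt (rlInt γ φ) := hφ.rlInt hγ
  have hK := (locInt_rlKernel (add_pos_of_pos_of_nonneg hα hγ)).const_mul c
  have h0 : 0 ≤ 1 - α - γ := by linarith
  rw [hD]
  -- After applying I^{1-α-γ}, both sides become c + I¹φ.
  refine ⟨hDl, rlInt_injective hf.1 ((hDl.rlInt hα.le).add hK) h0 ?_⟩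
  have e1 := rlInt_rlInt hφ hα.le hγ
  have e2 := rlInt_rlInt hφ h0 (add_nonneg hα.le hγ)
  have e3 := rlInt_rlKernel h0 (add_pos_of_pos_of_nonneg hα hγ)
  rw [show 1 - α - γ + (α + γ) = 1 by ring] at e2 e3
  filter_upwards [hg, rlInt_add (hDl.rlInt hα.le) hK h0, rlInt_congr e1 (1 - α - γ), e2, e3]
    with x hx h1 h2 h3 h4
  rw [hx]
  refine Eq.trans ?_ h1.symm
  rw [h2, h3, rlInt_const_mul, h4, add_comm]

/-- The inversion of the 2nd level derivative. -/
theorem MemDom2L.ae_eq {α γ₁ γ₂ : ℝ} (hα : 0 < α) (hγ₁ : 0 ≤ γ₁) (hγ₂ : 0 ≤ γ₂) (h1 : α + γ₁ ≤ 1)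
    (h2 : α + γ₁ + γ₂ ≤ 2) (h3 : 1 < α + γ₁ + γ₂) {f : ℝ → ℂ} (hf : MemDom2L α γ₁ γ₂ f) :
    LocInt (deriv2L α γ₁ γ₂ f) ∧ f =ᵐ[posVol] fun x => rlInt α (deriv2L α γ₁ γ₂ f) x +
      (coeffA1 α γ₁ γ₂ f * rlKernel (α + γ₁) x +
        coeffA2 α γ₁ γ₂ f * rlKernel (α + γ₁ + γ₂ - 1) x) := by
  obtain ⟨hl, hm1, hm2⟩ := hf
  obtain ⟨hφ, hg⟩ := isACRep_iff.1 hm1.isACRep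
  obtain ⟨hψ, hg'⟩ := isACRep_iff.1 hm2.isACRep
  simp only [deriv2L, coeffA1, coeffA2]
  set β := 2 - α - γ₁ - γ₂
  set a₂ := valueAtZero (rlInt β f)
  set φ := acDeriv (rlInt β f)
  set a₁ := valueAtZero (rlInt γ₂ φ)
  set ψ := acDeriv (rlInt γ₂ φ)
  have hβ : 0 ≤ β := by simp only [β]; linarith
  have hp1 : 0 < α + γ₁ := by linarith
  have hp2 : 0 < α + γ₁ + γ₂ - 1 := by linarith
  have hD : LocInt (rlInt γ₁ ψ) := hψ.rlInt hγ₁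
  have hK1 := (locInt_rlKernel hp1).const_mul a₁
  have hK2 := (locInt_rlKernel hp2).const_mul a₂
  have h0 : 0 ≤ γ₂ + β := by linarith
  -- The order γ₂ + β equals 2-α-γ₁. The facts `l1`-`l10` unfold I^{γ₂} I^β f through the two AC
  -- representations, commuting I^{γ₂} past I¹; `r1`-`r6` evaluate the right side. Both give I²ψ +
  -- a₁ k₂ + a₂ k_{γ₂+1}.
  refine ⟨hD, rlInt_injective hl ((hD.rlInt hα.le).add (hK1.add hK2)) h0 ?_⟩
  have l1 := rlInt_rlInt hl hγ₂ hβ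
  have l2 := rlInt_congr hg γ₂
  have l3 := rlInt_add ((locInt_rlKernel one_pos).const_mul a₂) (hφ.rlInt zero_le_one) hγ₂
  have l4 := rlInt_rlKernel hγ₂ one_pos
  have l5 := rlInt_rlInt hφ hγ₂ zero_le_one
  have l6 := rlInt_rlInt hφ zero_le_one hγ₂
  have l7 := rlInt_congr hg' 1
  have l8 := rlInt_add ((locInt_rlKernel one_pos).const_mul a₁) (hψ.rlInt zero_le_one) zero_le_one
  have l9 := rlInt_rlKernel zero_le_one one_pos
  have l10 := rlInt_rlInt hψ zero_le_one zero_le_one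
  have r1 := rlInt_add (hD.rlInt hα.le) (hK1.add hK2) h0
  have r2 := rlInt_add hK1 hK2 h0
  have r3 := rlInt_rlKernel h0 hp1
  have r4 := rlInt_rlKernel h0 hp2
  have r5 := rlInt_congr (rlInt_rlInt hψ hα.le hγ₁) (γ₂ + β)
  have r6 := rlInt_rlInt hψ h0 hp1.le
  rw [add_comm] at l6
  rw [show γ₂ + β + (α + γ₁) = 1 + 1 by simp only [β]; ring] at r3 r6
  rw [show γ₂ + β + (α + γ₁ + γ₂ - 1) = γ₂ + 1 by simp only [β]; ring] at r4
  filter_upwards [l1, l2, l3, l4, l5, l6, l7, l8, l9, l10, r1, r2, r3, r4, r5, r6]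
    with x l1 l2 l3 l4 l5 l6 l7 l8 l9 l10 r1 r2 r3 r4 r5 r6
  simp only [rlInt_const_mul] at l3 l8 r2
  rw [← l1, l2, l3, l4, l5, ← l6, l7, l8, l9, l10]
  refine Eq.trans ?_ r1.symm
  rw [r5, r6]
  refine Eq.trans ?_ (congrArg _ r2.symm)
  rw [r3, r4]
  ring

/-! ### Degenerate types of the 2nd level derivative -/

/-- The outer domain condition holds by itself: I^{γ₂} applied to an L_loc function vanishes at 0
and has derivative of order γ₂-1, which merges with I^{γ₁}. -/
theorem memDom2L_iff_of_one_le {α γ₁ γ₂ : ℝ} (hγ₁ : 0 ≤ γ₁) (h : 1 ≤ γ₂) (f : ℝ → ℂ) :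
    (MemDom2L α γ₁ γ₂ f ↔ MemDomHilfer α (γ₁ + γ₂ - 1) f) ∧
      (MemDom2L α γ₁ γ₂ f →
        deriv2L α γ₁ γ₂ f =ᵐ[posVol] derivHilfer α (γ₁ + γ₂ - 1) f ∧
        coeffA1 α γ₁ γ₂ f = 0 ∧
        coeffA2 α γ₁ γ₂ f = valueAtZero (rlInt (1 - α - (γ₁ + γ₂ - 1)) f)) := by
  have e : 1 - α - (γ₁ + γ₂ - 1) = 2 - α - γ₁ - γ₂ := by ring
  simp only [MemDom2L, MemDomHilfer, deriv2L, derivHilfer, coeffA1, coeffA2, e]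
  set g := rlInt (2 - α - γ₁ - γ₂) f
  have key : MemAC g → IsACRep (rlInt γ₂ (acDeriv g)) 0 (rlInt (γ₂ - 1) (acDeriv g)) :=
    fun hg => isACRep_rlInt hg.isACRep.1 h
  refine ⟨⟨fun h => ⟨h.1, h.2.1⟩, fun h => ⟨h.1, h.2, _, _, key h.2⟩⟩, fun hf => ?_⟩
  have hk := key hf.2.1
  refine ⟨(rlInt_congr hk.acDeriv_ae_eq γ₁).trans ?_, hk.valueAtZero_eq, trivial⟩
  have := rlInt_rlInt hf.2.1.isACRep.1 hγ₁ (sub_nonneg.2 h)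
  rwa [← add_sub_assoc] at this

/-- Here the innermost order is at least 1, so the inner domain condition holds by itself with value
0 at the origin; differentiating lowers the order by one, and I^{γ₂} raises it to 1-α-γ₁. -/
theorem memDom2L_iff_of_add_le_one {α γ₁ γ₂ : ℝ} (hγ₂ : 0 ≤ γ₂) (h : α + γ₁ + γ₂ ≤ 1)
    (f : ℝ → ℂ) :
    (MemDom2L α γ₁ γ₂ f ↔ MemDomHilfer α γ₁ f) ∧
      (MemDom2L α γ₁ γ₂ f →
        deriv2L α γ₁ γ₂ f =ᵐ[posVol] derivHilfer α γ₁ f ∧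
        coeffA1 α γ₁ γ₂ f = valueAtZero (rlInt (1 - α - γ₁) f) ∧
        coeffA2 α γ₁ γ₂ f = 0) := by
  simp only [MemDom2L, MemDomHilfer, deriv2L, derivHilfer, coeffA1, coeffA2]
  set β := 2 - α - γ₁ - γ₂ with hβ
  have hβ1 : 1 ≤ β := by linarith
  have key : LocInt f → IsACRep (rlInt β f) 0 (rlInt (β - 1) f) := fun hf => isACRep_rlInt hf hβ1
  have key2 : LocInt f → rlInt γ₂ (acDeriv (rlInt β f)) =ᵐ[posVol] rlInt (1 - α - γ₁) f := by
    intro hf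
    have := rlInt_rlInt hf hγ₂ (sub_nonneg.2 hβ1)
    rw [show γ₂ + (β - 1) = 1 - α - γ₁ by rw [hβ]; ring] at this
    exact (rlInt_congr (key hf).acDeriv_ae_eq γ₂).trans this
  refine ⟨⟨fun hf => ⟨hf.1, hf.2.2.congr (key2 hf.1)⟩,
    fun hf => ⟨hf.1, ⟨_, _, key hf.1⟩, hf.2.congr (key2 hf.1).symm⟩⟩, fun hf => ?_⟩
  have hr := hf.2.2.isACRep.congr (key2 hf.1) EventuallyEq.rfl
  exact ⟨rlInt_congr hr.acDeriv_ae_eq.symm γ₁, hr.valueAtZero_eq.symm, (key hf.1).valueAtZero_eq⟩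

end FracCalc

namespace FracCalc

/-! ### The Laplace transform -/

/-- The integrand `f(t) e^{-st}` of the Laplace transform. -/
noncomputable def expWeight (s : ℂ) (f : ℝ → ℂ) (t : ℝ) : ℂ := f t * Complex.exp (-(s * t))

/-- The improper Laplace integral of `f` converges to `F` at `s`. -/
def HasLaplace (f : ℝ → ℂ) (s F : ℂ) : Prop :=
  Tendsto (fun R : ℝ => ∫ t in (0 : ℝ)..R, expWeight s f t) atTop (𝓝 F)

theorem HasLaplace.laplace_eq {f : ℝ → ℂ} {s F : ℂ} (h : HasLaplace f s F) : laplace f s = F :=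
  h.limUnder_eq

theorem LaplaceExists.hasLaplace {f : ℝ → ℂ} {s : ℂ} (h : LaplaceExists f s) :
    HasLaplace f s (laplace f s) := by
  obtain ⟨F, hF⟩ := h.2
  rwa [HasLaplace.laplace_eq hF]

theorem continuous_expWeight_factor (s : ℂ) :
    Continuous fun t : ℝ => Complex.exp (-(s * t)) := by fun_prop

theorem LocInt.expWeight {f : ℝ → ℂ} (hf : LocInt f) (s : ℂ) : LocInt (expWeight s f) := by
  refine locInt_iff.2 fun b => IntegrableOn.mono_set ?_ Ioc_subset_Icc_self
  exact (hf.integrableOn_compact_subset Icc_subset_Ici_self isCompact_Icc).mul_continuousOn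
    (continuous_expWeight_factor s).continuousOn isCompact_Icc

theorem HasLaplace.congr {f g : ℝ → ℂ} {s F : ℂ} (h : HasLaplace f s F) (hfg : f =ᵐ[posVol] g) :
    HasLaplace g s F := by
  refine Tendsto.congr' ?_ h
  filter_upwards [eventually_ge_atTop 0] with R hR
  refine integral_congr_pos ?_ hR
  filter_upwards [hfg] with t ht
  rw [FracCalc.expWeight, FracCalc.expWeight, ht]

theorem HasLaplace.add {f g : ℝ → ℂ} {s F G : ℂ} (hf : LocInt f) (hg : LocInt g)
    (hF : HasLaplace f s F) (hG : HasLaplace g s G) :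
    HasLaplace (fun t => f t + g t) s (F + G) := by
  refine Tendsto.congr' ?_ (Tendsto.add hF hG)
  filter_upwards [eventually_ge_atTop 0] with R hR
  rw [← intervalIntegral.integral_add ((hf.expWeight s).intervalIntegrable le_rfl hR)
    ((hg.expWeight s).intervalIntegrable le_rfl hR)]
  simp only [FracCalc.expWeight, add_mul]

theorem HasLaplace.const_mul {f : ℝ → ℂ} {s F : ℂ} (hF : HasLaplace f s F) (c : ℂ) :
    HasLaplace (fun t => c * f t) s (c * F) := by
  refine Tendsto.congr (fun R => ?_) (Tendsto.const_mul c hF)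
  rw [← intervalIntegral.integral_const_mul]
  simp only [FracCalc.expWeight, mul_assoc]

/-- Multiplicativity of the exponential reduces Laplace transforms of convolutions to plain
integrals of convolutions. -/
theorem expWeight_hconv (s : ℂ) (f g : ℝ → ℂ) :
    expWeight s (hconv f g) = hconv (expWeight s f) (expWeight s g) := by
  funext x
  rw [expWeight, hconv, hconv, ← intervalIntegral.integral_mul_const]
  refine intervalIntegral.integral_congr fun t _ => ?_
  simp only [expWeight]
  rw [show -(s * (x : ℂ)) = -(s * t) + -(s * ((x - t : ℝ) : ℂ)) by push_cast; ring,
    Complex.exp_add]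
  ring

/-- If `∫₀^R f` converges as `R → ∞` and `k` is integrable on `(0, ∞)`, then the integral of
their convolution converges to the product. -/
theorem tendsto_integral_hconv {f k : ℝ → ℂ} {F : ℂ} (hf : LocInt f)
    (hF : Tendsto (fun R : ℝ => ∫ t in (0 : ℝ)..R, f t) atTop (𝓝 F))
    (hk : IntegrableOn k (Ioi 0)) :
    Tendsto (fun R : ℝ => ∫ t in (0 : ℝ)..R, hconv k f t) atTop
      (𝓝 ((∫ t in Ioi (0 : ℝ), k t) * F)) := by
  have hkl : LocInt k := locInt_iff.2 fun b => hk.mono_set Ioc_subset_Ioi_self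
  -- Extension by zero makes the primitive `G` continuous on ℝ and zero on the negative axis, so
  -- G(R-u) makes sense for u > R and the integral over (0, R) can be taken over (0, ∞).
  set f₀ : ℝ → ℂ := indicator (Ioi 0) f
  set G : ℝ → ℂ := fun y => ∫ t in (0 : ℝ)..y, f₀ t
  have hint : ∀ a b : ℝ, IntervalIntegrable f₀ volume a b := by
    intro a b
    rw [intervalIntegrable_iff, integrableOn_indicator_iff measurableSet_Ioi]
    refine (locInt_iff.1 hf (max a b)).mono_set fun x hx => ⟨hx.1, ?_⟩
    exact (mem_Ioc.1 hx.2).2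
  have hGc : Continuous G := intervalIntegral.continuous_primitive hint 0
  have hGpos : ∀ y, 0 ≤ y → G y = ∫ t in (0 : ℝ)..y, f t := by
    intro y hy
    refine integral_congr_pos ?_ hy
    filter_upwards [ae_restrict_mem measurableSet_Ioi] with t ht using indicator_of_mem ht f
  have hGneg : ∀ y, y ≤ 0 → G y = 0 := by
    intro y hy
    simp only [G]
    rw [intervalIntegral.integral_symm, intervalIntegral.integral_of_le hy, neg_eq_zero]
    exact setIntegral_eq_zero_of_forall_eq_zero fun t ht =>
      indicator_of_notMem (fun h : t ∈ Ioi 0 => absurd ht.2 (not_le.2 h)) f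
  have hGlim : Tendsto G atTop (𝓝 F) := by
    refine hF.congr' ?_
    filter_upwards [eventually_ge_atTop 0] with y hy using (hGpos y hy).symm
  obtain ⟨C, hC⟩ : ∃ C, ∀ y, ‖G y‖ ≤ C := by
    have h1 : ∀ᶠ y in atTop, ‖G y‖ < ‖F‖ + 1 :=
      hGlim.norm.eventually_lt_const (lt_add_one _)
    obtain ⟨R, hR⟩ := eventually_atTop.1 h1
    obtain ⟨C, hC⟩ := (isCompact_Icc (a := (0 : ℝ)) (b := R)).exists_bound_of_continuousOn
      hGc.continuousOn
    refine ⟨max C (‖F‖ + 1), fun y => ?_⟩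
    rcases le_total y 0 with hy | hy
    · rw [hGneg y hy, norm_zero]
      exact le_max_of_le_right (by positivity)
    rcases le_total y R with hyR | hyR
    · exact le_max_of_le_left (hC y ⟨hy, hyR⟩)
    · exact le_max_of_le_right (hR y hyR).le
  -- Dominated convergence with majorant C|k|: for fixed u, G(R-u) → F.
  have hlim : Tendsto (fun R : ℝ => ∫ u in Ioi (0 : ℝ), k u * G (R - u)) atTop
      (𝓝 (∫ u in Ioi (0 : ℝ), k u * F)) := by
    refine tendsto_integral_filter_of_dominated_convergence (fun u => ‖k u‖ * C)
      (Eventually.of_forall fun R => ?_) (Eventually.of_forall fun R =>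
        Eventually.of_forall fun u => ?_) (hk.norm.mul_const C) (Eventually.of_forall fun u => ?_)
    · exact hk.aestronglyMeasurable.mul
        (by fun_prop : Continuous fun u => G (R - u)).aestronglyMeasurable
    · rw [norm_mul]
      gcongr
      exact hC _
    · refine (hGlim.comp ?_).const_mul (k u)
      exact tendsto_atTop_add_const_right atTop (-u) tendsto_id
  rw [integral_mul_const] at hlim
  refine hlim.congr' ?_
  filter_upwards [eventually_ge_atTop 0] with R hR
  have h1l : LocInt fun _ => (1 : ℂ) := by
    rw [locInt_iff]; intro b; simp
  -- Integration over (0, R) is convolution with 1, so (k * f) * 1 = k * (f * 1), and f * 1 is the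
  -- primitive `G`.
  rw [← hconv_one, hconv_assoc_of_bounded hkl hf h1l (C := 1) (by simp) hR, hconv,
    intervalIntegral.integral_of_le hR, eq_comm]
  rw [setIntegral_eq_of_subset_of_forall_sdiff_eq_zero measurableSet_Ioi
    (Ioc_subset_Ioi_self : Ioc 0 R ⊆ Ioi 0) (f := fun u => k u * G (R - u))]
  · refine setIntegral_congr_fun measurableSet_Ioc fun u hu => ?_
    simp only [hconv_one]
    rw [hGpos _ (sub_nonneg.2 hu.2)]
  · intro u hu
    have : R ≤ u := by
      by_contra h
      exact hu.2 ⟨hu.1, (not_le.1 h).le⟩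
    rw [hGneg _ (by linarith), mul_zero]

/-- The kernel of the fractional integral has an absolutely convergent Laplace transform. -/
theorem integrableOn_expWeight_rlKernel {β : ℝ} (hβ : 0 < β) {s : ℂ} (hs : 0 < s.re) :
    IntegrableOn (expWeight s (rlKernel β)) (Ioi 0) := by
  have h := (integrableOn_rpow_mul_exp_neg_mul_rpow (p := 1) (s := β - 1) (b := s.re)
    (by linarith) one_pos hs).div_const (Real.Gamma β)
  refine Integrable.mono' h ?_ ?_
  · refine AEStronglyMeasurable.mul ?_ (continuous_expWeight_factor s).aestronglyMeasurable
    refine Complex.continuous_ofReal.comp_aestronglyMeasurable ?_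
    exact ((measurable_id.pow_const (β - 1)).div_const _).aestronglyMeasurable
  · filter_upwards [ae_restrict_mem measurableSet_Ioi] with t ht
    have ht0 : (0 : ℝ) < t := ht
    have hΓ := Real.Gamma_pos_of_pos hβ
    rw [expWeight, rlKernel, norm_mul, Complex.norm_real, Complex.norm_exp, Real.norm_of_nonneg
      (by positivity), Real.rpow_one]
    simp only [Complex.neg_re, Complex.mul_re, Complex.ofReal_re, Complex.ofReal_im, mul_zero,
      sub_zero]
    rw [neg_mul, div_mul_eq_mul_div]

/-- Supplies holomorphy for the continuation of the kernel's transform from the positive reals to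
the right half-plane. -/
theorem differentiableAt_integral_rlKernel {β : ℝ} (hβ : 0 < β) {s : ℂ} (hs : 0 < s.re) :
    DifferentiableAt ℂ (fun z => ∫ t in Ioi (0 : ℝ), expWeight z (rlKernel β) t) s := by
  have hΓ := Real.Gamma_pos_of_pos hβ
  -- On this half-plane the z-derivative of the integrand is dominated by t^β e^{-(Re s/2)t}/Γ(β).
  have hU : {z : ℂ | s.re / 2 < z.re} ∈ 𝓝 s :=
    (isOpen_lt continuous_const Complex.continuous_re).mem_nhds (by simp; linarith)
  have hb := (integrableOn_rpow_mul_exp_neg_mul_rpow (p := 1) (s := β) (b := s.re / 2)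
    (by linarith) one_pos (by linarith)).div_const (Real.Gamma β)
  have hmeas : ∀ z, AEStronglyMeasurable (expWeight z (rlKernel β)) posVol := by
    intro z
    refine AEStronglyMeasurable.mul ?_ (continuous_expWeight_factor z).aestronglyMeasurable
    refine Complex.continuous_ofReal.comp_aestronglyMeasurable ?_
    exact ((measurable_id.pow_const (β - 1)).div_const _).aestronglyMeasurable
  refine (hasDerivAt_integral_of_dominated_loc_of_deriv_le (μ := posVol)
    (F' := fun z t => expWeight z (rlKernel β) t * (-(t : ℂ))) hU
    (Eventually.of_forall hmeas) (integrableOn_expWeight_rlKernel hβ hs)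
    ((hmeas s).mul (by fun_prop : Continuous fun t : ℝ => -(t : ℂ)).aestronglyMeasurable)
    ?_ hb ?_).2.differentiableAt
  · filter_upwards [ae_restrict_mem measurableSet_Ioi] with t ht z hz
    have ht0 : (0 : ℝ) < t := ht
    have hz' : s.re / 2 < z.re := hz
    rw [expWeight, rlKernel, norm_mul, norm_mul, Complex.norm_real, Complex.norm_exp,
      Real.norm_of_nonneg (by positivity), Real.rpow_one, norm_neg, Complex.norm_real,
      Real.norm_of_nonneg ht0.le]
    simp only [Complex.neg_re, Complex.mul_re, Complex.ofReal_re, Complex.ofReal_im, mul_zero,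
      sub_zero]
    have e : t ^ β = t ^ (β - 1) * t := by
      rw [← Real.rpow_add_one ht0.ne', sub_add_cancel]
    have he : Real.exp (-(z.re * t)) ≤ Real.exp (-(s.re / 2) * t) :=
      Real.exp_le_exp.2 (by nlinarith)
    rw [e]
    calc t ^ (β - 1) / Real.Gamma β * Real.exp (-(z.re * t)) * t
        ≤ t ^ (β - 1) / Real.Gamma β * Real.exp (-(s.re / 2) * t) * t := by gcongr
      _ = t ^ (β - 1) * t * Real.exp (-(s.re / 2) * t) / Real.Gamma β := by ring
  · refine Eventually.of_forall fun t z _ => ?_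
    have h1 : HasDerivAt (fun z : ℂ => -(z * t)) (-(t : ℂ)) z := by
      simpa using ((hasDerivAt_id z).mul_const (t : ℂ)).fun_neg
    have := (h1.cexp).const_mul (rlKernel β t)
    simpa only [expWeight, mul_assoc] using this

/-- The Laplace transform of the kernel of the fractional integral. -/
theorem integral_expWeight_rlKernel {β : ℝ} (hβ : 0 < β) {s : ℂ} (hs : 0 < s.re) :
    ∫ t in Ioi (0 : ℝ), expWeight s (rlKernel β) t = s ^ (-β : ℂ) := by
  -- On the positive reals this is the Gamma integral.
  have hreal : ∀ r : ℝ, 0 < r →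
      ∫ t in Ioi (0 : ℝ), expWeight (r : ℂ) (rlKernel β) t = (r : ℂ) ^ (-β : ℂ) := by
    intro r hr
    have h := Complex.integral_cpow_mul_exp_neg_mul_Ioi (a := β) (by simpa using hβ) hr
    have hG : Complex.Gamma β ≠ 0 := Complex.Gamma_ne_zero_of_re_pos (by simpa using hβ)
    have e : ∫ t in Ioi (0 : ℝ), expWeight (r : ℂ) (rlKernel β) t = (Complex.Gamma β)⁻¹ *
        ∫ t in Ioi (0 : ℝ), (t : ℂ) ^ ((β : ℂ) - 1) * Complex.exp (-(r * t)) := by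
      rw [← integral_const_mul]
      refine setIntegral_congr_fun measurableSet_Ioi fun t ht => ?_
      simp only [expWeight, rlKernel]
      push_cast
      rw [Complex.ofReal_cpow (le_of_lt ht), ← Complex.Gamma_ofReal]
      push_cast
      ring
    rw [e, h, Complex.cpow_neg, one_div, Complex.inv_cpow]
    · field_simp
    · rw [Complex.arg_ofReal_of_nonneg hr.le]; exact Real.pi_pos.ne
  have hopen : IsOpen {z : ℂ | 0 < z.re} := isOpen_lt continuous_const Complex.continuous_re
  have hconn : IsPreconnected {z : ℂ | 0 < z.re} := (convex_halfSpace_re_gt 0).isPreconnected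
  have hf : AnalyticOnNhd ℂ (fun z => ∫ t in Ioi (0 : ℝ), expWeight z (rlKernel β) t)
      {z : ℂ | 0 < z.re} :=
    DifferentiableOn.analyticOnNhd (fun z hz =>
      (differentiableAt_integral_rlKernel hβ hz).differentiableWithinAt) hopen
  have hg : AnalyticOnNhd ℂ (fun z : ℂ => z ^ (-β : ℂ)) {z : ℂ | 0 < z.re} :=
    DifferentiableOn.analyticOnNhd (fun z hz => (DifferentiableAt.cpow_const
      differentiableAt_id (Or.inl hz)).differentiableWithinAt) hopen
  refine hf.eqOn_of_preconnected_of_frequently_eq hg hconn (z₀ := 1) (by simp) ?_ hs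
  -- For the identity theorem: real points distinct from 1 that accumulate at 1.
  have ht : Tendsto (fun n : ℕ => ((1 + 1 / ((n : ℝ) + 1) : ℝ) : ℂ)) atTop (𝓝[≠] 1) := by
    refine tendsto_nhdsWithin_iff.2 ⟨?_, Eventually.of_forall fun n => ?_⟩
    · have := (tendsto_one_div_add_atTop_nhds_zero_nat (𝕜 := ℝ)).const_add 1
      rw [add_zero] at this
      simpa [Function.comp_def] using (Complex.continuous_ofReal.tendsto 1).comp this
    · have : (0 : ℝ) < 1 / ((n : ℝ) + 1) := by positivity
      rw [mem_compl_singleton_iff]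
      exact_mod_cast (by linarith : (1 : ℝ) < 1 + 1 / ((n : ℝ) + 1)).ne'
  exact ht.frequently (Frequently.of_forall fun n => hreal _ (by positivity))

theorem hasLaplace_rlKernel {β : ℝ} (hβ : 0 < β) {s : ℂ} (hs : 0 < s.re) :
    HasLaplace (rlKernel β) s (s ^ (-β : ℂ)) := by
  rw [← integral_expWeight_rlKernel hβ hs]
  exact intervalIntegral_tendsto_integral_Ioi 0 (integrableOn_expWeight_rlKernel hβ hs) tendsto_id

/-- The Laplace transform of a fractional integral. -/
theorem HasLaplace.rlInt {f : ℝ → ℂ} {s F : ℂ} (hf : LocInt f) (hF : HasLaplace f s F)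
    (hs : 0 < s.re) {β : ℝ} (hβ : 0 < β) : HasLaplace (rlInt β f) s (s ^ (-β : ℂ) * F) := by
  have h := tendsto_integral_hconv (hf.expWeight s) hF (integrableOn_expWeight_rlKernel hβ hs)
  rw [integral_expWeight_rlKernel hβ hs, ← expWeight_hconv] at h
  rw [rlInt_eq_hconv hβ.ne', show hconv f (rlKernel β) = hconv (rlKernel β) f from
    funext fun x => hconv_comm f (rlKernel β) x]
  exact h

/-! ### Transform formulas for the 2nd level and Hilfer derivatives. -/

theorem laplace_deriv2L {α γ₁ γ₂ : ℝ} (hα : 0 < α) (hγ₁ : 0 ≤ γ₁) (hγ₂ : 0 ≤ γ₂)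
    (h1 : α + γ₁ ≤ 1) (h2 : α + γ₁ + γ₂ ≤ 2) (h3 : 1 < α + γ₁ + γ₂) {f : ℝ → ℂ}
    (hf : MemDom2L α γ₁ γ₂ f) {s : ℂ} (hs : 0 < s.re)
    (he : LaplaceExists (deriv2L α γ₁ γ₂ f) s) :
    LaplaceExists f s ∧ laplace (deriv2L α γ₁ γ₂ f) s =
      s ^ (α : ℂ) * laplace f s - coeffA1 α γ₁ γ₂ f * s ^ (-γ₁ : ℂ)
        - coeffA2 α γ₁ γ₂ f * s ^ (1 - γ₁ - γ₂ : ℂ) := by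
  obtain ⟨hD, hfe⟩ := hf.ae_eq hα hγ₁ hγ₂ h1 h2 h3
  have hp1 : 0 < α + γ₁ := by linarith
  have hp2 : 0 < α + γ₁ + γ₂ - 1 := by linarith
  have hK1 := (locInt_rlKernel hp1).const_mul (coeffA1 α γ₁ γ₂ f)
  have hK2 := (locInt_rlKernel hp2).const_mul (coeffA2 α γ₁ γ₂ f)
  -- Transforming the inversion formula term by term yields convergence for f together with its
  -- value.
  have hL := ((he.hasLaplace.rlInt hD hs hα).add (hD.rlInt hα.le) (hK1.add hK2)
    (((hasLaplace_rlKernel hp1 hs).const_mul _).add hK1 hK2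
      ((hasLaplace_rlKernel hp2 hs).const_mul _))).congr hfe.symm
  refine ⟨⟨hf.1, _, hL⟩, ?_⟩
  have hs0 : s ≠ 0 := fun h => by simp [h] at hs
  have e0 : s ^ (α : ℂ) * s ^ (-α : ℂ) = 1 := by
    rw [← Complex.cpow_add _ _ hs0, add_neg_cancel, Complex.cpow_zero]
  have e1 : s ^ (α : ℂ) * s ^ (-((α + γ₁ : ℝ) : ℂ)) = s ^ (-γ₁ : ℂ) := by
    rw [← Complex.cpow_add _ _ hs0]; push_cast; ring_nf
  have e2 : s ^ (α : ℂ) * s ^ (-((α + γ₁ + γ₂ - 1 : ℝ) : ℂ)) = s ^ (1 - γ₁ - γ₂ : ℂ) := by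
    rw [← Complex.cpow_add _ _ hs0]; push_cast; ring_nf
  rw [hL.laplace_eq]
  linear_combination -laplace (deriv2L α γ₁ γ₂ f) s * e0 - coeffA1 α γ₁ γ₂ f * e1 -
    coeffA2 α γ₁ γ₂ f * e2

theorem laplace_derivHilfer {α γ : ℝ} (hα : 0 < α) (hγ : 0 ≤ γ) (h1 : α + γ ≤ 1) {f : ℝ → ℂ}
    (hf : MemDomHilfer α γ f) {s : ℂ} (hs : 0 < s.re)
    (he : LaplaceExists (derivHilfer α γ f) s) :
    LaplaceExists f s ∧ laplace (derivHilfer α γ f) s =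
      s ^ (α : ℂ) * laplace f s - valueAtZero (rlInt (1 - α - γ) f) * s ^ (-γ : ℂ) := by
  obtain ⟨hD, hfe⟩ := hf.ae_eq hα hγ h1
  have hp : 0 < α + γ := by linarith
  have hL := ((he.hasLaplace.rlInt hD hs hα).add (hD.rlInt hα.le)
    ((locInt_rlKernel hp).const_mul (valueAtZero (rlInt (1 - α - γ) f)))
    ((hasLaplace_rlKernel hp hs).const_mul _)).congr hfe.symm
  refine ⟨⟨hf.1, _, hL⟩, ?_⟩
  have hs0 : s ≠ 0 := fun h => by simp [h] at hs
  have e0 : s ^ (α : ℂ) * s ^ (-α : ℂ) = 1 := by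
    rw [← Complex.cpow_add _ _ hs0, add_neg_cancel, Complex.cpow_zero]
  have e1 : s ^ (α : ℂ) * s ^ (-((α + γ : ℝ) : ℂ)) = s ^ (-γ : ℂ) := by
    rw [← Complex.cpow_add _ _ hs0]; push_cast; ring_nf
  rw [hL.laplace_eq]
  linear_combination -laplace (derivHilfer α γ f) s * e0 -
    valueAtZero (rlInt (1 - α - γ) f) * e1

theorem derivHilfer_zero (α : ℝ) (f : ℝ → ℂ) : derivHilfer α 0 f = derivRL α f := by
  rw [derivHilfer, derivRL, rlInt_zero, sub_zero]

theorem derivHilfer_one_sub (α : ℝ) (f : ℝ → ℂ) :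
    derivHilfer α (1 - α) f = derivCaputo α f := by
  rw [derivHilfer, derivCaputo, sub_self, rlInt_zero]

end FracCalc

open FracCalc in
theorem mainTheorem4 (α : ℝ) (hα : 0 < α) (hα1 : α ≤ 1) :
    -- the truly 2nd level derivative
    (∀ γ₁ γ₂ : ℝ, 0 ≤ γ₁ → 0 ≤ γ₂ → α + γ₁ ≤ 1 → α + γ₁ + γ₂ ≤ 2 →
      γ₂ < 1 → 1 < α + γ₁ + γ₂ →
      ∀ f : ℝ → ℂ, MemDom2L α γ₁ γ₂ f →
      ∀ s : ℂ, 0 < s.re → LaplaceExists (deriv2L α γ₁ γ₂ f) s →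
        LaplaceExists f s ∧
        laplace (deriv2L α γ₁ γ₂ f) s =
          s ^ (α : ℂ) * laplace f s - coeffA1 α γ₁ γ₂ f * s ^ (-γ₁ : ℂ)
            - coeffA2 α γ₁ γ₂ f * s ^ (1 - γ₁ - γ₂ : ℂ)) ∧
    -- degenerate types: the Hilfer derivative of type `γ₁ + γ₂ - 1` if `1 ≤ γ₂`
    (∀ γ₁ γ₂ : ℝ, 0 ≤ γ₁ → 0 ≤ γ₂ → α + γ₁ ≤ 1 → α + γ₁ + γ₂ ≤ 2 → 1 ≤ γ₂ →
      ∀ f : ℝ → ℂ, (MemDom2L α γ₁ γ₂ f ↔ MemDomHilfer α (γ₁ + γ₂ - 1) f) ∧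
        (MemDom2L α γ₁ γ₂ f →
          deriv2L α γ₁ γ₂ f =ᵐ[volume.restrict (Ioi (0 : ℝ))]
            derivHilfer α (γ₁ + γ₂ - 1) f ∧
          coeffA1 α γ₁ γ₂ f = 0 ∧
          coeffA2 α γ₁ γ₂ f = valueAtZero (rlInt (1 - α - (γ₁ + γ₂ - 1)) f))) ∧
    -- degenerate types: the Hilfer derivative of type `γ₁` if `α + γ₁ + γ₂ ≤ 1`
    (∀ γ₁ γ₂ : ℝ, 0 ≤ γ₁ → 0 ≤ γ₂ → α + γ₁ ≤ 1 → α + γ₁ + γ₂ ≤ 2 → α + γ₁ + γ₂ ≤ 1 →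
      ∀ f : ℝ → ℂ, (MemDom2L α γ₁ γ₂ f ↔ MemDomHilfer α γ₁ f) ∧
        (MemDom2L α γ₁ γ₂ f →
          deriv2L α γ₁ γ₂ f =ᵐ[volume.restrict (Ioi (0 : ℝ))] derivHilfer α γ₁ f ∧
          coeffA1 α γ₁ γ₂ f = valueAtZero (rlInt (1 - α - γ₁) f) ∧
          coeffA2 α γ₁ γ₂ f = 0)) ∧
    -- Hilfer
    (∀ γ₁ : ℝ, 0 ≤ γ₁ → α + γ₁ ≤ 1 →
      ∀ f : ℝ → ℂ, MemDomHilfer α γ₁ f →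
      ∀ s : ℂ, 0 < s.re → LaplaceExists (derivHilfer α γ₁ f) s →
        LaplaceExists f s ∧
        laplace (derivHilfer α γ₁ f) s =
          s ^ (α : ℂ) * laplace f s - valueAtZero (rlInt (1 - α - γ₁) f) * s ^ (-γ₁ : ℂ)) ∧
    -- Riemann-Liouville: `γ₁ = 0`
    (∀ f : ℝ → ℂ, MemDomRL α f →
      (MemDomHilfer α 0 f ∧ derivHilfer α 0 f = derivRL α f) ∧
      ∀ s : ℂ, 0 < s.re → LaplaceExists (derivRL α f) s →
        LaplaceExists f s ∧
        laplace (derivRL α f) s =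
          s ^ (α : ℂ) * laplace f s - valueAtZero (rlInt (1 - α) f)) ∧
    -- Caputo: `γ₁ = 1 - α`
    (∀ f : ℝ → ℂ, MemAC f →
      (MemDomHilfer α (1 - α) f ∧ derivHilfer α (1 - α) f = derivCaputo α f) ∧
      ∀ s : ℂ, 0 < s.re → LaplaceExists (derivCaputo α f) s →
        LaplaceExists f s ∧
        laplace (derivCaputo α f) s =
          s ^ (α : ℂ) * laplace f s - valueAtZero f * s ^ (α - 1 : ℂ)) := by
  refine ⟨fun γ₁ γ₂ hγ₁ hγ₂ h1 h2 _ h3 f hf s hs he =>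
      laplace_deriv2L hα hγ₁ hγ₂ h1 h2 h3 hf hs he,
    fun γ₁ γ₂ hγ₁ _ _ _ h f => memDom2L_iff_of_one_le hγ₁ h f,
    fun γ₁ γ₂ _ hγ₂ _ _ h f => memDom2L_iff_of_add_le_one hγ₂ h f,
    fun γ₁ hγ₁ h1 f hf s hs he => laplace_derivHilfer hα hγ₁ h1 hf hs he,
    fun f hf => ?_, fun f hf => ?_⟩
  · have hm : MemDomHilfer α 0 f := by rwa [MemDomHilfer, sub_zero]
    refine ⟨⟨hm, derivHilfer_zero α f⟩, fun s hs he => ?_⟩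
    rw [← derivHilfer_zero] at he ⊢
    have h := laplace_derivHilfer hα le_rfl (by linarith) hm hs he
    rwa [sub_zero, Complex.ofReal_zero, neg_zero, Complex.cpow_zero, mul_one] at h
  -- The inner order 1-α-(1-α) is 0, so the Hilfer domain reduces to AC, whose members are locally
  -- integrable.
  · have hm : MemDomHilfer α (1 - α) f := by
      refine ⟨hf.locInt, ?_⟩
      rwa [sub_self, rlInt_zero]
    refine ⟨⟨hm, derivHilfer_one_sub α f⟩, fun s hs he => ?_⟩
    rw [← derivHilfer_one_sub] at he ⊢
    have h := laplace_derivHilfer hα (sub_nonneg.2 hα1) (by linarith) hm hs he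
    rwa [sub_self, rlInt_zero, Complex.ofReal_sub, Complex.ofReal_one, neg_sub] at h
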